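/- Let $G_1,G_2$ be finite simple graphs, each on $n$ vertices, with maximum degrees $\Delta_1\ge\Delta_2$ respectively, such that $(\Delta_1+1)(\Delta_2+1)\le n+1$. Suppose that neither $G_1$ nor $G_2$ contains a cycle of length $4$, $6$ or $8$ as a (not necessarily induced) subgraph, and that $\Delta_1\ge 940060$ or $\Delta_2\ge 27620$. Then $G_1$ and $G_2$ pack; that is, there are injective maps $f_1\colon V(G_1)\to\{1,\dots,n\}$ and $f_2\colon V(G_2)\to\{1,\dots,n\}$ such that the edge sets $\{\{f_1(u),f_1(v)\}: uv\in E(G_1)\}$ and $\{\{f_2(u),f_2(v)\}: uv\in E(G_2)\}$ are disjoint. -/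

import Mathlib

/-- Two graphs pack into `n` labels if their vertex sets can be mapped injectively into an
`n`-element set (here `Fin n`) so that the images of their edge sets are disjoint. -/
def SimpleGraph.PackInto {V₁ V₂ : Type*} (n : ℕ) (G₁ : SimpleGraph V₁) (G₂ : SimpleGraph V₂) :
    Prop :=
  ∃ (f₁ : V₁ ↪ Fin n) (f₂ : V₂ ↪ Fin n),
    Disjoint (Sym2.map f₁ '' G₁.edgeSet) (Sym2.map f₂ '' G₂.edgeSet)

/-- `G` contains no cycle on 4, 6 or 8 vertices as a (not necessarily induced) subgraph. -/
def SimpleGraph.NoCycle468 {V : Type*} (G : SimpleGraph V) : Prop :=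
  (SimpleGraph.cycleGraph 4).Free G ∧ (SimpleGraph.cycleGraph 6).Free G ∧
    (SimpleGraph.cycleGraph 8).Free G

/-! Take a bijection of the vertex sets with the fewest shared edges, and view both graphs as `G`,
`H` on one vertex set with maximum degrees `D ≥ d`. If an edge at `u` is shared, some relabelling of
`H` by a transposition or a 4-cycle `u → a → c → b → u` removes the overlap at `u` and adds none,
contradicting minimality. Such a move fails only if a short mixed path, one edge in each graph,
joins a vertex to its new position. Let `A` be the admissible targets for `u` and `B` the vertices
that may move to `u`; both are large. If every move fails, then for `a ∈ A`, `b ∈ B`, every `c`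
outside a small set is linked to `a` or to `b`. But few `c` are linked to both of two vertices `a₁`,
`a₂` (`card_filter_adj_both_le`, from the absence of 4- and 8-cycles). The same count for `b₁`,
`b₂`, or, when `d` is small, a pigeonhole on `d + 1` vertices of `B` (`card_filter_linked_all_le`),
leaves a `c` that works. -/

namespace SimpleGraph

/-! ### Counting consequences of having no 4- and 8-cycles. -/

variable {V : Type*}

/-- Any two distinct vertices have at most one common neighbour. -/
def CodegreeLeOne (G : SimpleGraph V) : Prop :=
  ∀ ⦃x y a b : V⦄, x ≠ y → G.Adj x a → G.Adj y a → G.Adj x b → G.Adj y b → a = b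

lemma CodegreeLeOne.of_free {G : SimpleGraph V} (h : (cycleGraph 4).Free G) :
    G.CodegreeLeOne := by
  intro x y a b hxy hxa hya hxb hyb
  by_contra hab
  refine h ⟨⟨⟨![x, a, y, b], ?_⟩, ?_⟩⟩
  · intro i j hij
    rw [cycleGraph_adj] at hij
    fin_cases i <;> fin_cases j <;>
      first
      | (exfalso; revert hij; decide)
      | simp [hxa, hya, hxb, hyb, hxa.symm, hya.symm, hxb.symm, hyb.symm]
  · intro i j hij
    have h1 := hxa.ne; have h2 := hya.ne; have h3 := hxb.ne; have h4 := hyb.ne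
    fin_cases i <;> fin_cases j <;> first | rfl | (exfalso; simp at hij; grind)

/-- The cycle `x c y e x' e' y' c'` on eight distinct vertices is a copy of `cycleGraph 8`. -/
lemma not_free_cycleGraph_eight {G : SimpleGraph V} (x y x' y' c e e' c' : V)
    (hnd : [x, y, x', y', c, e, e', c'].Nodup)
    (h1 : G.Adj c x) (h2 : G.Adj c y) (h3 : G.Adj e y) (h4 : G.Adj e x') (h5 : G.Adj e' x')
    (h6 : G.Adj e' y') (h7 : G.Adj c' y') (h8 : G.Adj c' x) : ¬ (cycleGraph 8).Free G := by
  intro h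
  refine h ⟨⟨⟨![x, c, y, e, x', e', y', c'], ?_⟩, ?_⟩⟩
  · intro i j hij
    rw [cycleGraph_adj] at hij
    fin_cases i <;> fin_cases j <;>
      first
      | (exfalso; revert hij; decide)
      | simp [h1, h2, h3, h4, h5, h6, h7, h8, h1.symm, h2.symm, h3.symm, h4.symm, h5.symm,
          h6.symm, h7.symm, h8.symm]
  · have : List.Nodup [x, c, y, e, x', e', y', c'] := by
      simp only [List.nodup_cons, List.mem_cons, List.not_mem_nil, not_or] at hnd ⊢
      grind
    have h2 := List.nodup_iff_injective_get.1 this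
    intro i j hij
    apply h2
    fin_cases i <;> fin_cases j <;> first | rfl | simpa using hij

lemma nodup_of_mem_of_notMem {X Y : Finset V} {x y x' y' c e e' c' : V} (hx : x ∈ X)
    (hx' : x' ∈ X) (hxY : x ∉ Y) (hxY' : x' ∉ Y) (hy : y ∈ Y) (hy' : y' ∈ Y)
    (hc : c ∉ X ∧ c ∉ Y) (he : e ∉ X ∧ e ∉ Y) (he' : e' ∉ X ∧ e' ∉ Y) (hc' : c' ∉ X ∧ c' ∉ Y)
    (hxx : x ≠ x') (hyy : y ≠ y') (h1 : c ≠ e) (h2 : c ≠ e') (h3 : c ≠ c') (h4 : e ≠ e')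
    (h5 : e ≠ c') (h6 : e' ≠ c') :
    [x, y, x', y', c, e, e', c'].Nodup := by
  simp only [List.nodup_cons, List.mem_cons, List.not_mem_nil, not_or]
  and_intros <;> first | trivial | exact List.nodup_nil | grind

variable [Fintype V] [DecidableEq V]

/-- In a graph without 4- and 8-cycles, few vertices have neighbours in both of two small,
almost disjoint sets. -/
lemma card_filter_adj_both_le {G : SimpleGraph V} [DecidableRel G.Adj] {m k : ℕ}
    (h4 : G.CodegreeLeOne) (h8 : (cycleGraph 8).Free G) (hdeg : ∀ x, G.degree x ≤ k)
    {X Y : Finset V} (hX : X.card ≤ m) (hY : Y.card ≤ m) (hXY : (X ∩ Y).card ≤ 1) :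
    ∃ e : ℕ, e ^ 2 ≤ m ^ 3 + m * e ∧
      (Finset.univ.filter fun c => c ∉ X ∧ c ∉ Y ∧ (∃ x ∈ X, G.Adj c x) ∧
        ∃ y ∈ Y, G.Adj c y).card ≤ k + e := by
  classical
  set C := Finset.univ.filter fun c => c ∉ X ∧ c ∉ Y ∧ (∃ x ∈ X, G.Adj c x) ∧
        ∃ y ∈ Y, G.Adj c y with hC
  -- View each `c ∈ C₁` as an edge `f c`–`g c` between `X` and `Y`: distinct `c` give distinct
  -- edges, and a 4-cycle of these edges is an 8-cycle of `G`. What follows is the Kővári–Sós–Turán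
  -- double count.
  set C₁ := C.filter fun c => ∀ w ∈ X ∩ Y, ¬ G.Adj c w with hC₁
  have hC₁C : C₁ ⊆ C := Finset.filter_subset _ _
  have hC₀ : (C \ C₁).card ≤ k := by
    calc _ ≤ ((X ∩ Y).biUnion fun w => G.neighborFinset w).card := by
          apply Finset.card_le_card
          intro c hc
          simp only [hC₁, Finset.mem_sdiff, Finset.mem_filter, not_and, not_forall, not_not] at hc
          obtain ⟨w, hw, hcw⟩ := hc.2 hc.1
          simp only [Finset.mem_biUnion, mem_neighborFinset]
          exact ⟨w, hw, hcw.symm⟩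
      _ ≤ (X ∩ Y).card * k := Finset.card_biUnion_le_card_mul _ _ _ fun w _ => by
          simpa using hdeg w
      _ ≤ 1 * k := Nat.mul_le_mul_right _ hXY
      _ = k := one_mul k
  have hmem : ∀ c ∈ C₁, ∃ x y, x ∈ X ∧ y ∈ Y ∧ x ∉ Y ∧ G.Adj c x ∧ G.Adj c y := by
    intro c hc
    simp only [hC₁, hC, Finset.mem_filter, Finset.mem_univ, true_and, Finset.mem_inter] at hc
    obtain ⟨⟨-, -, ⟨x, hx, hcx⟩, y, hy, hcy⟩, hw⟩ := hc
    exact ⟨x, y, hx, hy, fun h => hw x ⟨hx, h⟩ hcx, hcx, hcy⟩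
  choose! f g hfX hgY hfY hf hg using hmem
  have hCX : ∀ c ∈ C₁, c ∉ X ∧ c ∉ Y := by
    intro c hc
    simp only [hC₁, hC, Finset.mem_filter] at hc
    exact ⟨hc.1.2.1, hc.1.2.2.1⟩
  have hinj : ∀ c ∈ C₁, ∀ c' ∈ C₁, f c = f c' → g c = g c' → c = c' := by
    intro c hc c' hc' h1 h2
    have hne : f c ≠ g c := fun h => hfY c hc (h ▸ hgY c hc)
    exact h4 hne (hf c hc).symm (hg c hc).symm (h1 ▸ (hf c' hc').symm) (h2 ▸ (hg c' hc').symm)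
  refine ⟨C₁.card, ?_, ?_⟩
  · have hsum : C₁.card = ∑ x ∈ X, (C₁.filter fun c => f c = x).card :=
      Finset.card_eq_sum_card_fiberwise hfX
    have hcs := sq_sum_le_card_mul_sum_sq (s := X)
      (f := fun x => (C₁.filter fun c => f c = x).card)
    rw [← hsum] at hcs
    have hsq : ∑ x ∈ X, (C₁.filter fun c => f c = x).card ^ 2
        = ((C₁ ×ˢ C₁).filter fun p => f p.1 = f p.2).card := by
      rw [Finset.card_eq_sum_card_fiberwise (f := fun p => f p.1) (t := X)]
      · refine Finset.sum_congr rfl fun x _ => ?_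
        rw [sq, ← Finset.card_product]
        congr 1
        ext ⟨a, b⟩
        simp only [Finset.mem_product, Finset.mem_filter]
        grind
      · intro p hp
        simp only [Finset.coe_filter, Finset.mem_product, Set.mem_ofPred_eq] at hp
        exact hfX _ hp.1.1
    have hdiag : ((C₁ ×ˢ C₁).filter fun p => f p.1 = f p.2).card
        ≤ C₁.card + Y.card * Y.card := by
      rw [← Finset.diag_card C₁, ← Finset.card_product]
      have hsub : ((C₁ ×ˢ C₁).filter fun p => f p.1 = f p.2) ⊆
          C₁.diag ∪ (C₁.offDiag.filter fun p => f p.1 = f p.2) := by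
        intro p hp
        simp only [Finset.mem_filter, Finset.mem_product, Finset.mem_union, Finset.mem_diag,
          Finset.mem_offDiag] at hp ⊢
        grind
      refine (Finset.card_le_card hsub).trans ((Finset.card_union_le _ _).trans ?_)
      refine Nat.add_le_add_left ?_ _
      refine Finset.card_le_card_of_injOn (fun p => (g p.1, g p.2)) ?_ ?_
      · intro p hp
        simp only [Finset.coe_filter, Finset.mem_offDiag, Set.mem_ofPred_eq] at hp
        exact Finset.mem_product.2 ⟨hgY _ hp.1.1, hgY _ hp.1.2.1⟩
      · rintro ⟨c, c'⟩ hp ⟨e, e'⟩ hq hpq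
        simp only [Finset.coe_filter, Finset.mem_offDiag, Set.mem_ofPred_eq] at hp hq
        obtain ⟨⟨hc, hc', hcc⟩, hfc⟩ := hp
        obtain ⟨⟨he, he', hee⟩, hfe⟩ := hq
        simp only [Prod.mk.injEq] at hpq ⊢
        obtain ⟨hg1, hg2⟩ := hpq
        by_cases hx : f c = f e
        · exact ⟨hinj c hc e he hx hg1, hinj c' hc' e' he' (by grind) hg2⟩
        · exfalso
          have hy : g c ≠ g c' := fun h => hcc (hinj c hc c' hc' hfc h)
          refine not_free_cycleGraph_eight (f c) (g c) (f e) (g c') c e e' c' ?_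
            (hf c hc) (hg c hc) (hg1 ▸ hg e he) (hf e he) (hfe ▸ hf e' he')
            (hg2 ▸ hg e' he') (hg c' hc') (hfc ▸ hf c' hc') h8
          exact nodup_of_mem_of_notMem (hfX c hc) (hfX e he) (hfY c hc) (hfY e he) (hgY c hc)
            (hgY c' hc') (hCX c hc) (hCX e he) (hCX e' he') (hCX c' hc') hx hy
            (fun h => hx (h ▸ rfl)) (fun h => hx (by rw [h, hfe])) hcc hee
            (fun h => hx (by rw [h, hfc])) (fun h => hx (by rw [hfc, ← h, hfe]))
    rw [hsq] at hcs
    calc C₁.card ^ 2 ≤ X.card * _ := hcs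
      _ ≤ m * (C₁.card + m * m) :=
        Nat.mul_le_mul hX (hdiag.trans (Nat.add_le_add_left (Nat.mul_le_mul hY hY) _))
      _ = m ^ 3 + m * C₁.card := by ring
  · have := Finset.card_sdiff_add_card_eq_card hC₁C
    omega

/-- Few vertices `c` are linked to all of more than `d` vertices `b` by a path `b x c` with first
edge in `G` and second edge in `H`, if `H` has maximum degree at most `d`. -/
lemma card_filter_linked_all_le {G H : SimpleGraph V} [DecidableRel G.Adj] [DecidableRel H.Adj]
    {d : ℕ} (h4 : G.CodegreeLeOne) (hdeg : ∀ x, H.degree x ≤ d) {B : Finset V}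
    (hB : d < B.card) :
    (Finset.univ.filter fun c => ∀ b ∈ B, ∃ x, G.Adj b x ∧ H.Adj x c).card
      ≤ B.card.choose 2 * d := by
  classical
  calc _ ≤ ((B.powersetCard 2).biUnion fun s =>
        Finset.univ.filter fun c => ∃ x, (∀ b ∈ s, G.Adj b x) ∧ H.Adj x c).card := by
        apply Finset.card_le_card
        intro c hc
        simp only [Finset.mem_filter, Finset.mem_univ, true_and] at hc
        choose! f hfG hfH using hc
        -- The middle vertices are `H`-neighbours of `c`, at most `d` of them, so two vertices of
        -- `B` share one. That pair determines it, by `h4`.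
        obtain ⟨b, hb, b', hb', hne, heq⟩ := Finset.exists_ne_map_eq_of_card_lt_of_maps_to
          (t := H.neighborFinset c) (f := f) (s := B) (by
            have := hdeg c
            rw [card_neighborFinset_eq_degree]; omega)
          (fun b hb => by simpa using (hfH b hb).symm)
        simp only [Finset.mem_biUnion, Finset.mem_powersetCard, Finset.mem_filter,
          Finset.mem_univ, true_and]
        refine ⟨{b, b'}, ⟨by grind, Finset.card_pair hne⟩, f b, ?_, hfH b hb⟩
        intro z hz
        simp only [Finset.mem_insert, Finset.mem_singleton] at hz
        rcases hz with rfl | rfl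
        · exact hfG _ hb
        · exact heq ▸ hfG _ hb'
    _ ≤ (B.powersetCard 2).card * d := by
        refine Finset.card_biUnion_le_card_mul _ _ _ fun s hs => ?_
        obtain ⟨b, b', hne, rfl⟩ := Finset.card_eq_two.1 (Finset.mem_powersetCard.1 hs).2
        by_cases hx : ∃ x, G.Adj b x ∧ G.Adj b' x
        · obtain ⟨x, hbx, hbx'⟩ := hx
          refine (Finset.card_le_card ?_).trans (hdeg x)
          intro c hc
          simp only [Finset.mem_filter, Finset.mem_univ, true_and, Finset.mem_insert,
            Finset.mem_singleton, forall_eq_or_imp, forall_eq] at hc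
          obtain ⟨y, ⟨h1, h2⟩, hy⟩ := hc
          obtain rfl := h4 hne hbx hbx' h1 h2
          simpa using hy
        · rw [Finset.card_eq_zero.2]
          · exact Nat.zero_le _
          · ext c
            simp only [Finset.mem_filter, Finset.mem_univ, true_and, Finset.mem_insert,
              Finset.mem_singleton, forall_eq_or_imp, forall_eq, Finset.notMem_empty, iff_false]
            rintro ⟨y, ⟨h1, h2⟩, -⟩
            exact hx ⟨y, h1, h2⟩
    _ = _ := by rw [Finset.card_powersetCard]

end SimpleGraph

/-! ### Numerical estimates. -/

namespace SimpleGraph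

/-- Here `e₂` is about `D^(3/2)`, at most about `√(2/3) * D * d`, and `e₁` is at most a tenth of `D
* d`; the linear terms fit in the rest. -/
lemma count_dense {D d n e₁ e₂ : ℕ} (hD : 27620 ≤ D) (hd : d ≤ D) (h : 3 * D ≤ 2 * d ^ 2)
    (hn : (D + 1) * (d + 1) ≤ n + 1) (he₁ : e₁ ^ 2 ≤ d ^ 3 + d * e₁)
    (he₂ : e₂ ^ 2 ≤ D ^ 3 + D * e₂) : 4 * D + 6 * d + 5 + e₁ + e₂ < n := by
  have hd2 : 200 ≤ d := by nlinarith
  have h1 : 10 * e₁ ≤ D * d := by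
    suffices 10 * e₁ ≤ d * d from this.trans (Nat.mul_le_mul_right _ hd)
    by_contra! hlt
    zify at *
    have h3 : (0 : ℤ) < d := by linarith
    have h4 : (d : ℤ) * 20 < e₁ := by nlinarith
    nlinarith [mul_pos h3 h3]
  have h2 : 100 * e₂ ≤ 85 * (D * d) := by
    by_contra! hlt
    zify at *
    have h3 : (0 : ℤ) < D := by linarith
    have h5 : (85 * d - 100 : ℤ) * D < 100 * (e₂ - D) := by nlinarith
    have h6 : (85 * d : ℤ) * D < 100 * e₂ := by nlinarith
    have h7 : (85 * d * D : ℤ) * ((85 * d - 100) * D) < 100 * e₂ * (100 * (e₂ - D)) := by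
      apply mul_lt_mul'' h6 h5
      · positivity
      · apply mul_nonneg <;> linarith
    have h8 : (e₂ : ℤ) * (e₂ - D) ≤ D ^ 3 := by linarith
    have h9 : (85 * d * (85 * d - 100) : ℤ) * (D * D) < 10000 * D * (D * D) := by nlinarith
    have h10 := lt_of_mul_lt_mul_right h9 (by positivity)
    nlinarith
  nlinarith

/-- The main term is about `d ^ 3 / 2`, which is below `(3 / 4) * D * d`. -/
lemma count_sparse {D d n e : ℕ} (hD : 27620 ≤ D) (hd : 0 < d) (h : 2 * d ^ 2 < 3 * D)
    (hn : (D + 1) * (d + 1) ≤ n + 1) (he : e ^ 2 ≤ d ^ 3 + d * e) :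
    D + e + (d + 1).choose 2 * d + (d + 4) + d * (d + 4) < n := by
  have h1 : e ≤ d ^ 2 := by
    by_contra! hlt
    zify at *
    have h3 : (d : ℤ) ≤ d ^ 2 := by nlinarith
    nlinarith
  have h2 : 2 * (d + 1).choose 2 = (d + 1) * d := by
    rw [Nat.choose_two_right, Nat.add_sub_cancel]
    exact Nat.mul_div_cancel' (by simpa [mul_comm] using (Nat.even_mul_succ_self d).two_dvd)
  have h5 : d ^ 2 < 2 * D := by nlinarith
  have h4 : d * 30 < D := by
    by_contra! h'
    nlinarith
  have h6 : (d + 1) * d + 4 * d + 16 < 2 * D := by nlinarith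
  have h7 : ((d + 1) * d + 4 * d + 16) * d < 2 * D * d := Nat.mul_lt_mul_of_pos_right h6 hd
  have h8 : 2 * ((d + 1).choose 2 * d) = (d + 1) * d * d := by rw [← mul_assoc, h2]
  nlinarith

end SimpleGraph

/-! ### Relabellings that reduce the overlap. -/

namespace SimpleGraph

variable {V : Type*}

/-- `a` and `c` are joined by a walk of length two whose first edge is in `G` and whose second edge
is in `H`. -/
def Linked (G H : SimpleGraph V) (a c : V) : Prop :=
  ∃ x, G.Adj a x ∧ H.Adj x c

/-- The permutation `τ` of the vertices of `H` creates no new edge shared with `G`, and removes all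
shared edges at `u`. -/
def ReducesOverlap (G H : SimpleGraph V) (u : V) (τ : Equiv.Perm V) : Prop :=
  ∀ x y, H.Adj x y → G.Adj (τ x) (τ y) → G.Adj x y ∧ x ≠ u ∧ y ≠ u

lemma reducesOverlap_of_support {G H : SimpleGraph V} {u : V} {τ : Equiv.Perm V} (T : Set V)
    (hu : u ∈ T) (hτ : ∀ x ∉ T, τ x = x)
    (h1 : ∀ x ∈ T, ∀ y ∉ T, H.Adj x y → ¬ G.Adj (τ x) y)
    (h2 : ∀ x ∈ T, ∀ y ∈ T, H.Adj x y → ¬ G.Adj (τ x) (τ y)) : G.ReducesOverlap H u τ := by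
  intro x y hxy hG
  by_cases hx : x ∈ T <;> by_cases hy : y ∈ T
  · exact absurd hG (h2 x hx y hy hxy)
  · exact absurd (hτ y hy ▸ hG) (h1 x hx y hy hxy)
  · exact absurd (hτ x hx ▸ hG.symm) (h1 y hy x hx hxy.symm)
  · rw [hτ x hx, hτ y hy] at hG
    exact ⟨hG, fun h => hx (h ▸ hu), fun h => hy (h ▸ hu)⟩

variable [DecidableEq V]

lemma reducesOverlap_swap {G H : SimpleGraph V} {u a : V} (h : ¬ H.Adj u a)
    (h1 : ¬ H.Linked G u a) (h2 : ¬ G.Linked H u a) :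
    G.ReducesOverlap H u (Equiv.swap u a) := by
  have h' : ¬ H.Adj a u := fun h' => h h'.symm
  refine reducesOverlap_of_support {u, a} (by simp) ?_ ?_ ?_
  · intro x hx
    simp only [Set.mem_insert_iff, Set.mem_singleton_iff, not_or] at hx
    exact Equiv.swap_apply_of_ne_of_ne hx.1 hx.2
  · rintro x (rfl | rfl) y - hxy hG
    · rw [Equiv.swap_apply_left] at hG
      exact h1 ⟨y, hxy, hG.symm⟩
    · rw [Equiv.swap_apply_right] at hG
      exact h2 ⟨y, hG, hxy.symm⟩
  · rintro x (rfl | rfl) y (rfl | rfl) hxy <;> first | exact absurd rfl hxy.ne | contradiction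

/-- The relabelling is `u → a → c → b → u`, one non-linking hypothesis per moved vertex. Among the
moved vertices only `ab` can be an edge of `H`; it lands on `cu`, whence `hab`. -/
lemma exists_reducesOverlap_of_cycle {G H : SimpleGraph V} {u a b c : V} (hua : ¬ H.Adj u a)
    (hub : ¬ H.Adj u b) (huc : ¬ H.Adj u c) (hac : ¬ H.Adj a c) (hbc : ¬ H.Adj b c)
    (hau : a ≠ u) (hbu : b ≠ u) (hcu : c ≠ u) (hca : c ≠ a) (hcb : c ≠ b)
    (h1 : ¬ H.Linked G u a) (h2 : ¬ H.Linked G a c) (h3 : ¬ G.Linked H b c)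
    (h4 : ¬ G.Linked H u b) (hab : ¬ H.Adj a b ∨ ¬ G.Adj u c) :
    ∃ τ, G.ReducesOverlap H u τ := by
  by_cases hne : a = b
  · subst hne
    exact ⟨_, reducesOverlap_swap hua h1 h4⟩
  set τ : Equiv.Perm V := Equiv.swap u b * Equiv.swap u c * Equiv.swap u a with hτ
  have t1 : τ u = a := by
    simp [hτ, Equiv.swap_apply_of_ne_of_ne, hau, hca.symm, hne]
  have t2 : τ a = c := by
    simp [hτ, Equiv.swap_apply_of_ne_of_ne, hcu, hcb]
  have t3 : τ c = b := by
    simp [hτ, Equiv.swap_apply_of_ne_of_ne, hcu, hca]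
  have t4 : τ b = u := by
    simp [hτ, Equiv.swap_apply_of_ne_of_ne, hbu, hcb.symm, Ne.symm hne]
  refine ⟨τ, reducesOverlap_of_support {u, a, b, c} (by simp) ?_ ?_ ?_⟩
  · intro x hx
    simp only [Set.mem_insert_iff, Set.mem_singleton_iff, not_or] at hx
    simp [hτ, Equiv.swap_apply_of_ne_of_ne, hx.1, hx.2.1, hx.2.2.1, hx.2.2.2]
  · rintro x (rfl | rfl | rfl | rfl) y - hxy hG
    · exact h1 ⟨y, hxy, (t1 ▸ hG).symm⟩
    · exact h2 ⟨y, hxy, (t2 ▸ hG).symm⟩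
    · exact h4 ⟨y, t4 ▸ hG, hxy.symm⟩
    · exact h3 ⟨y, t3 ▸ hG, hxy.symm⟩
  · have s1 := fun h => hua (Adj.symm h); have s2 := fun h => hub (Adj.symm h)
    have s3 := fun h => huc (Adj.symm h); have s4 := fun h => hac (Adj.symm h)
    have s5 := fun h => hbc (Adj.symm h)
    rintro x (rfl | rfl | rfl | rfl) y (rfl | rfl | rfl | rfl) hxy <;>
      first
      | exact absurd rfl hxy.ne
      | contradiction
      | (rw [t2, t4]; intro hG; exact hab.elim (fun h => h hxy) (fun h => h hG.symm))
      | (rw [t4, t2]; intro hG; exact hab.elim (fun h => h hxy.symm) (fun h => h hG))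

lemma card_union_le_add {s t : Finset V} {p q : ℕ} (hs : s.card ≤ p) (ht : t.card ≤ q) :
    (s ∪ t).card ≤ p + q :=
  (Finset.card_union_le _ _).trans (Nat.add_le_add hs ht)

variable [Fintype V]

lemma exists_notMem_of_card_le {s : Finset V} {k : ℕ} (h : s.card ≤ k)
    (hk : k < Fintype.card V) : ∃ c, c ∉ s := by
  by_contra! hall
  rw [Finset.eq_univ_of_forall hall, Finset.card_univ] at h
  omega

open Classical in
lemma card_filter_linked_le {G H : SimpleGraph V} [DecidableRel G.Adj] [DecidableRel H.Adj]
    {p q : ℕ} (hG : ∀ x, G.degree x ≤ p) (hH : ∀ x, H.degree x ≤ q) (a : V) :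
    (Finset.univ.filter fun c => G.Linked H a c).card ≤ p * q := by
  calc _ ≤ ((G.neighborFinset a).biUnion fun x => H.neighborFinset x).card := by
        apply Finset.card_le_card
        intro c hc
        obtain ⟨x, h1, h2⟩ := (Finset.mem_filter.1 hc).2
        simpa using ⟨x, h1, h2⟩
    _ ≤ (G.neighborFinset a).card * q := Finset.card_biUnion_le_card_mul _ _ _ fun x _ => by
        simpa using hH x
    _ ≤ p * q := Nat.mul_le_mul_right _ (by simpa using hG a)

open Classical in
lemma le_card_filter_not_linked {G H K : SimpleGraph V} [DecidableRel G.Adj] [DecidableRel H.Adj]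
    [DecidableRel K.Adj] {p q r s : ℕ} (hG : ∀ x, G.degree x ≤ p) (hH : ∀ x, H.degree x ≤ q)
    (hK : ∀ x, K.degree x ≤ r) (hs : s + p * q + r ≤ Fintype.card V) (u : V) :
    s ≤ (Finset.univ.filter fun a => ¬ K.Adj u a ∧ ¬ G.Linked H u a).card := by
  have h1 := card_filter_linked_le hG hH u
  have h2 : (Finset.univ : Finset V) ⊆
      ((Finset.univ.filter fun a => ¬ K.Adj u a ∧ ¬ G.Linked H u a) ∪
        (Finset.univ.filter fun c => G.Linked H u c)) ∪ K.neighborFinset u := by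
    intro x _
    simp only [Finset.mem_union, Finset.mem_filter, Finset.mem_univ, true_and,
      mem_neighborFinset]
    tauto
  have h3 := (Finset.card_le_card h2).trans
    ((Finset.card_union_le _ _).trans (Nat.add_le_add_right (Finset.card_union_le _ _) _))
  rw [Finset.card_univ, card_neighborFinset_eq_degree] at h3
  have := hK u
  omega

lemma CodegreeLeOne.card_inter_neighborFinset_le {G : SimpleGraph V} [DecidableRel G.Adj]
    (h : G.CodegreeLeOne) {a b : V} (hab : a ≠ b) :
    (G.neighborFinset a ∩ G.neighborFinset b).card ≤ 1 := by
  rw [Finset.card_le_one]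
  intro x hx y hy
  simp only [Finset.mem_inter, mem_neighborFinset] at hx hy
  exact h hab hx.1 hx.2 hy.1 hy.2

/-- The overlap of two placed graphs without 4- and 8-cycles that share an edge at `u` can be
reduced at `u`, if the graphs are sparse enough. -/
theorem exists_reducesOverlap {G H : SimpleGraph V} [DecidableRel G.Adj] [DecidableRel H.Adj]
    {D d : ℕ} (hG : ∀ x, G.degree x ≤ D) (hH : ∀ x, H.degree x ≤ d) (hdD : d ≤ D)
    (hD : 27620 ≤ D) (hn : (D + 1) * (d + 1) ≤ Fintype.card V + 1) (hG4 : G.CodegreeLeOne)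
    (hH4 : H.CodegreeLeOne) (hG8 : (cycleGraph 8).Free G) (hH8 : (cycleGraph 8).Free H)
    {u v : V} (huv : G.Adj u v) (huv' : H.Adj u v) : ∃ τ, G.ReducesOverlap H u τ := by
  classical
  by_contra hno
  have hd : 0 < d := lt_of_lt_of_le ((H.degree_pos_iff_exists_adj u).2 ⟨v, huv'⟩) (hH u)
  set A := Finset.univ.filter fun a => ¬ H.Adj u a ∧ ¬ H.Linked G u a with hA
  set B := Finset.univ.filter fun b => ¬ H.Adj u b ∧ ¬ G.Linked H u b with hB
  have hAcard : D ≤ A.card := le_card_filter_not_linked hH hG hH (by nlinarith) u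
  have hBcard : D ≤ B.card := le_card_filter_not_linked hG hH hH (by nlinarith) u
  have key : ∀ a ∈ A, ∀ b ∈ B, ∀ c, ¬ H.Adj u c → ¬ H.Adj a c → ¬ H.Adj b c → c ≠ u → c ≠ a →
      c ≠ b → (¬ H.Adj a b ∨ ¬ G.Adj u c) → H.Linked G a c ∨ G.Linked H b c := by
    intro a ha b hb c h1 h2 h3 h4 h5 h6 h7
    simp only [hA, hB, Finset.mem_filter, Finset.mem_univ, true_and] at ha hb
    by_contra! h8
    refine hno (exists_reducesOverlap_of_cycle ha.1 hb.1 h1 h2 h3 ?_ ?_ h4 h5 h6 ha.2 h8.1 h8.2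
      hb.2 h7)
    -- The shared edge `uv` links `u` to itself, so `u` lies in neither `A` nor `B`.
    · rintro rfl
      exact ha.2 ⟨v, huv', huv.symm⟩
    · rintro rfl
      exact hb.2 ⟨v, huv, huv'.symm⟩
  obtain ⟨a₁, ha₁, a₂, ha₂, ha⟩ := Finset.one_lt_card.1 (show 1 < A.card by omega)
  obtain ⟨e₁, he₁, hS₁⟩ := card_filter_adj_both_le hG4 hG8 hG
    (X := H.neighborFinset a₁) (Y := H.neighborFinset a₂) (m := d) (by simpa using hH a₁)
    (by simpa using hH a₂) (hH4.card_inter_neighborFinset_le ha)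
  have hbi : ∀ P : Finset V, (P.biUnion fun x => H.neighborFinset x).card ≤ P.card * d :=
    fun P => Finset.card_biUnion_le_card_mul _ _ _ fun x _ => by simpa using hH x
  have hNG : ∀ x, (G.neighborFinset x).card ≤ D := fun x => by simpa using hG x
  -- The count for `b₁`, `b₂` costs about `D^(3/2)` and the pigeonhole about `d ^ 3 / 2`. Against
  -- `n`, roughly `D * d`, these need `d ^ 2` above `D` and below `2 * D` respectively; the
  -- threshold lies in between.
  by_cases hcase : 3 * D ≤ 2 * d ^ 2
  · obtain ⟨b₁, hb₁, b₂, hb₂, hb⟩ := Finset.one_lt_card.1 (show 1 < B.card by omega)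
    obtain ⟨e₂, he₂, hS₂⟩ := card_filter_adj_both_le hH4 hH8 hH
      (X := G.neighborFinset b₁) (Y := G.neighborFinset b₂) (m := D) (by simpa using hG b₁)
      (by simpa using hG b₂) (hG4.card_inter_neighborFinset_le hb)
    have hP : ({u, a₁, a₂, b₁, b₂} : Finset V).card ≤ 5 := Finset.card_le_five
    have hcard := card_union_le_add (card_union_le_add (card_union_le_add (card_union_le_add
      (card_union_le_add (card_union_le_add hP ((hbi _).trans (Nat.mul_le_mul_right d hP)))
      (hNG u)) (hNG b₁)) (hNG b₂)) hS₁) hS₂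
    obtain ⟨c, hc⟩ := exists_notMem_of_card_le hcard (by
      have := count_dense hD hdD hcase hn he₁ he₂
      omega)
    simp only [Finset.mem_union, Finset.mem_insert, Finset.mem_singleton, Finset.mem_biUnion,
      mem_neighborFinset, Finset.mem_filter, Finset.mem_univ, true_and, not_or,
      exists_eq_or_imp, exists_eq_left] at hc
    obtain ⟨⟨⟨⟨⟨⟨⟨c1, c2, c3, c4, c5⟩, n1, n2, n3, n4, n5⟩, g1⟩, g2⟩, g3⟩, s1⟩, s2⟩ := hc
    have k11 := key a₁ ha₁ b₁ hb₁ c n1 n2 n4 c1 c2 c4 (Or.inr g1)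
    have k12 := key a₁ ha₁ b₂ hb₂ c n1 n2 n5 c1 c2 c5 (Or.inr g1)
    have k21 := key a₂ ha₂ b₁ hb₁ c n1 n3 n4 c1 c3 c4 (Or.inr g1)
    have k22 := key a₂ ha₂ b₂ hb₂ c n1 n3 n5 c1 c3 c5 (Or.inr g1)
    have f1 : ¬ (H.Linked G a₁ c ∧ H.Linked G a₂ c) := fun ⟨⟨x, h1, h2⟩, y, h3, h4⟩ =>
      s1 ⟨n2, n3, ⟨x, h1, h2.symm⟩, y, h3, h4.symm⟩
    have f2 : ¬ (G.Linked H b₁ c ∧ G.Linked H b₂ c) := fun ⟨⟨x, h1, h2⟩, y, h3, h4⟩ =>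
      s2 ⟨g2, g3, ⟨x, h1, h2.symm⟩, y, h3, h4.symm⟩
    -- Some `aᵢ` and some `bⱼ` are both unlinked to `c`, against `key`.
    rcases k11 with h | h
    · have h' : ¬ H.Linked G a₂ c := fun h' => f1 ⟨h, h'⟩
      exact f2 ⟨k21.resolve_left h', k22.resolve_left h'⟩
    · have h' : ¬ G.Linked H b₂ c := fun h' => f2 ⟨h, h'⟩
      exact f1 ⟨k12.resolve_right h', k22.resolve_right h'⟩
  · have hcase' : 2 * d ^ 2 < 3 * D := by omega
    -- Dropping the `H`-neighbours of `a₁`, `a₂` from `B` gives the first alternative in `key`.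
    -- Avoiding the `D` possible `G`-neighbours of `u` instead would exceed the budget when `d = 1`.
    have hlarge : d + 1 ≤ (B \ (H.neighborFinset a₁ ∪ H.neighborFinset a₂)).card := by
      have h1 := Finset.le_card_sdiff (H.neighborFinset a₁ ∪ H.neighborFinset a₂) B
      have h2 : (H.neighborFinset a₁ ∪ H.neighborFinset a₂).card ≤ d + d :=
        card_union_le_add (by simpa using hH a₁) (by simpa using hH a₂)
      have h3 : 4 * d < D := by nlinarith
      omega
    obtain ⟨B₀, hB₀, hB₀card⟩ := Finset.exists_subset_card_eq hlarge
    have hS₂ := card_filter_linked_all_le hG4 hH (B := B₀) (by omega)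
    rw [hB₀card] at hS₂
    have hP : (insert u (insert a₁ (insert a₂ B₀))).card ≤ d + 4 :=
      (Finset.card_insert_le _ _).trans (Nat.succ_le_succ ((Finset.card_insert_le _ _).trans
        (Nat.succ_le_succ ((Finset.card_insert_le _ _).trans (by omega)))))
    have hcard := card_union_le_add (card_union_le_add
      (card_union_le_add hP ((hbi _).trans (Nat.mul_le_mul_right d hP))) hS₁) hS₂
    obtain ⟨c, hc⟩ := exists_notMem_of_card_le hcard (by
      have := count_sparse hD hd hcase' hn he₁
      have := mul_comm d (d + 4)
      omega)
    simp only [Finset.mem_union, Finset.mem_insert, Finset.mem_biUnion,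
      mem_neighborFinset, Finset.mem_filter, Finset.mem_univ, true_and, not_or,
      exists_eq_or_imp] at hc
    obtain ⟨⟨⟨⟨c1, c2, c3, c4⟩, n1, n2, n3, n4⟩, s1⟩, s2⟩ := hc
    push Not at s2 n4
    obtain ⟨b, hb, hbc⟩ := s2
    have hbB := hB₀ hb
    simp only [Finset.mem_sdiff, Finset.mem_union, mem_neighborFinset, not_or] at hbB
    have hbc' : ¬ G.Linked H b c := fun ⟨x, h1, h2⟩ => hbc x h1 h2
    have hcb : c ≠ b := fun h => c4 (h ▸ hb)
    obtain ⟨x, h1, h2⟩ := (key a₁ ha₁ b hbB.1 c n1 n2 (n4 b hb) c1 c2 hcb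
      (Or.inl hbB.2.1)).resolve_right hbc'
    obtain ⟨y, h3, h4⟩ := (key a₂ ha₂ b hbB.1 c n1 n3 (n4 b hb) c1 c3 hcb
      (Or.inl hbB.2.2)).resolve_right hbc'
    exact s1 ⟨n2, n3, ⟨x, h1, h2.symm⟩, y, h3, h4.symm⟩

end SimpleGraph

/-! ### Minimal overlap and conclusion. -/

open SimpleGraph in
theorem exists_equiv_of_free {V₁ V₂ : Type*} [Fintype V₁] [Fintype V₂]
    (hV : Fintype.card V₂ = Fintype.card V₁) (G₁ : SimpleGraph V₁) (G₂ : SimpleGraph V₂)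
    [DecidableRel G₁.Adj] [DecidableRel G₂.Adj] (hΔ : G₂.maxDegree ≤ G₁.maxDegree)
    (hBEC : (G₁.maxDegree + 1) * (G₂.maxDegree + 1) ≤ Fintype.card V₁ + 1)
    (h₁4 : (cycleGraph 4).Free G₁) (h₁8 : (cycleGraph 8).Free G₁)
    (h₂4 : (cycleGraph 4).Free G₂) (h₂8 : (cycleGraph 8).Free G₂)
    (hD : 27620 ≤ G₁.maxDegree) :
    ∃ f : V₂ ≃ V₁, ∀ x y, G₂.Adj x y → ¬ G₁.Adj (f x) (f y) := by
  classical
  have : Nonempty (V₂ ≃ V₁) := Fintype.card_eq.1 hV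
  -- Shared edges are counted as ordered pairs, hence twice each, which does not affect minimality.
  let S : (V₂ ≃ V₁) → Finset (V₂ × V₂) := fun f =>
    Finset.univ.filter fun p => G₂.Adj p.1 p.2 ∧ G₁.Adj (f p.1) (f p.2)
  obtain ⟨f, hf⟩ := Finite.exists_min fun f => (S f).card
  refine ⟨f, fun x y hxy hG => ?_⟩
  set H : SimpleGraph V₁ := G₂.comap f.symm with hH
  let φ : H ≃g G₂ := Iso.comap f.symm G₂
  have hHdeg : ∀ z, H.degree z ≤ G₂.maxDegree := fun z => by
    rw [← φ.degree_eq z]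
    exact G₂.degree_le_maxDegree _
  have hfree : ∀ k, (cycleGraph k).Free G₂ → (cycleGraph k).Free H :=
    fun k h h' => h (h'.trans ⟨φ.toCopy⟩)
  obtain ⟨τ, hτ⟩ := exists_reducesOverlap (G := G₁) (H := H) G₁.degree_le_maxDegree hHdeg hΔ hD
    hBEC (.of_free h₁4) (.of_free (hfree 4 h₂4)) h₁8 (hfree 8 h₂8) hG (by simpa [hH] using hxy)
  refine (hf (f.trans τ)).not_gt (Finset.card_lt_card ?_)
  rw [Finset.ssubset_iff_of_subset]
  · refine ⟨(x, y), by simp [S, hxy, hG], fun h => ?_⟩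
    replace h := (Finset.mem_filter.1 h).2
    exact (hτ (f x) (f y) (by simpa [hH] using h.1) h.2).2.1 rfl
  · intro p h
    replace h := (Finset.mem_filter.1 h).2
    refine Finset.mem_filter.2 ⟨Finset.mem_univ _, h.1, (hτ (f p.1) (f p.2) (by simpa [hH] using h.1) h.2).1⟩

theorem mainTheorem1 {V₁ V₂ : Type*} [Fintype V₁] [Fintype V₂] (n : ℕ)
    (hV₁ : Fintype.card V₁ = n) (hV₂ : Fintype.card V₂ = n)
    (G₁ : SimpleGraph V₁) (G₂ : SimpleGraph V₂)
    [DecidableRel G₁.Adj] [DecidableRel G₂.Adj]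
    (hΔ : G₂.maxDegree ≤ G₁.maxDegree)
    (hBEC : (G₁.maxDegree + 1) * (G₂.maxDegree + 1) ≤ n + 1)
    (hG₁ : G₁.NoCycle468) (hG₂ : G₂.NoCycle468)
    (hlarge : 940060 ≤ G₁.maxDegree ∨ 27620 ≤ G₂.maxDegree) :
    SimpleGraph.PackInto n G₁ G₂ := by
  subst hV₁
  -- Either alternative of `hlarge` gives `27620 ≤ G₁.maxDegree`, the second through `hΔ`.
  obtain ⟨f, hf⟩ := exists_equiv_of_free hV₂ G₁ G₂ hΔ hBEC hG₁.1 hG₁.2.2 hG₂.1 hG₂.2.2 (by omega)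
  let g := Fintype.equivFin V₁
  refine ⟨g.toEmbedding, (f.trans g).toEmbedding, Set.disjoint_left.2 ?_⟩
  rintro _ ⟨p, hp, rfl⟩ ⟨q, hq, hqp⟩
  induction p with | _ a b
  induction q with | _ x y
  rw [SimpleGraph.mem_edgeSet] at hp hq
  simp only [Equiv.coe_toEmbedding, Sym2.map_mk, Equiv.trans_apply, Sym2.eq_iff,
    EmbeddingLike.apply_eq_iff_eq] at hqp
  rcases hqp with ⟨rfl, rfl⟩ | ⟨rfl, rfl⟩
  · exact hf x y hq hp
  · exact hf x y hq hp.symm
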